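/- Let $X$ be a real or complex infinite-dimensional separable reflexive Banach space. Let $\mathcal B(X)$ be the space of bounded operators on $X$ and let $\mathcal B_1(X)=\{T\in\mathcal B(X):\|T\|\le 1\}$. The topology $\mathrm{SOT}^*$ on $\mathcal B(X)$ is the topology of pointwise norm convergence of operators and of their adjoints: $T_i\to T$ in $\mathrm{SOT}^*$ if and only if $\|T_ix-Tx\|\to0$ for all $x\in X$ and $\|T_i^*x^*-T^*x^*\|\to 0$ for all $x^*\in X^*$. Assume the following. (1) $X$ is smooth, i.e. its norm is Gateaux differentiable at every $x\neq0$. (2) There is a duality mapping $\mathbf J:X\to X^*$ which is $(w,w^*)$-continuous on bounded sets, i.e. whose restriction to every bounded set is continuous from the weak topology of $X$ to the weak$^*$ topology of $X^*$. Here a duality mapping is a map $\mathbf J:X\to X^*$ such that $\mathbf J(0)=0$, $\mathbf J(x)\ne0$ for $x\neq0$, $\langle \mathbf J(x),x\rangle=\|\mathbf J(x)\|\,\|x\|$ for all $x\in X$, and $\|\mathbf J(x)\|$ depends only on $\|x\|$ and is a non-decreasing function of $\|x\|$. (3) There is a sequence $(P_N)_{N\ge0}$ of finite-rank $M$-like projections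 on $X$ such that $P_N\to I$ in $\mathrm{SOT}^*$. Here a projection $P\in\mathcal B(X)$ (that is, $P^2=P$) is called $M$-like if for every $T\in\mathcal B(X)$ $$\|PTP+(I-P)T(I-P)\|=\max\bigl(\|PTP\|,\|(I-P)T(I-P)\|\bigr).$$ Then a typical $T\in(\mathcal B_1(X),\mathrm{SOT}^*)$ does not attain its norm: the set of all $T\in\mathcal B_1(X)$ for which there is no $z\in X\setminus\{0\}$ with $\|Tz\|=\|T\|\,\|z\|$ contains a dense $G_\delta$ subset of $(\mathcal B_1(X),\mathrm{SOT}^*)$. -/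

import Mathlib

open Set Filter Topology

namespace NormAttaining

section

variable {𝕜 X : Type*} [RCLike 𝕜] [NormedAddCommGroup X] [NormedSpace 𝕜 X]

variable (𝕜 X) in
/-- `X` is reflexive: the canonical map of `X` into its bidual is onto. -/
def IsReflexive : Prop :=
  Function.Surjective (NormedSpace.inclusionInDoubleDual 𝕜 X)

variable (𝕜 X) in
/-- `X` is smooth: its norm is Gateaux differentiable at every nonzero point. A continuous real-linear
functional on `X` is the real part of a unique `𝕜`-linear one, so the Gateaux differential
at `x` is written as `v ↦ Re (f v)`. -/
def IsSmooth : Prop :=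
  ∀ x : X, x ≠ 0 → ∃ f : StrongDual 𝕜 X, ∀ v : X,
    HasDerivAt (fun t : ℝ => ‖x + (t : 𝕜) • v‖) (RCLike.re (f v)) 0

/-- `J` is a duality mapping for `X`. -/
structure IsDualityMapping (J : X → StrongDual 𝕜 X) : Prop where
  map_zero : J 0 = 0
  map_ne_zero : ∀ x : X, x ≠ 0 → J x ≠ 0
  pairing : ∀ x : X, J x x = ((‖J x‖ * ‖x‖ : ℝ) : 𝕜)
  norm_mono : ∃ c : ℝ → ℝ, MonotoneOn c (Ici 0) ∧ ∀ x : X, ‖J x‖ = c ‖x‖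

/-- The restriction of `J` to each bounded set is continuous from the weak topology of `X` to the
weak-star topology of the dual. -/
def IsWeakWeakStarContinuousOnBounded (J : X → StrongDual 𝕜 X) : Prop :=
  ∀ B : Set X, Bornology.IsBounded B →
    ContinuousOn
      (fun x : WeakSpace 𝕜 X => StrongDual.toWeakDual (J ((toWeakSpace 𝕜 X).symm x)))
      (toWeakSpace 𝕜 X '' B)

/-- `P` is an `M`-like projection. -/
structure IsMLikeProjection (P : X →L[𝕜] X) : Prop where
  idem : P * P = P
  norm_eq : ∀ T : X →L[𝕜] X,
    ‖P * T * P + (1 - P) * T * (1 - P)‖ = max ‖P * T * P‖ ‖(1 - P) * T * (1 - P)‖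

/-- The Banach space adjoint of `T`, as a map of the dual into itself. -/
def adj (T : X →L[𝕜] X) (φ : StrongDual 𝕜 X) : StrongDual 𝕜 X := φ.comp T

variable (𝕜 X) in
/-- The strong-star operator topology on the bounded operators: the coarsest topology for which all
`T ↦ T x` and all `T ↦ T* φ` are continuous for the norm topologies of `X` and its dual. -/
@[reducible] def sotStar : TopologicalSpace (X →L[𝕜] X) :=
  TopologicalSpace.induced (fun T (x : X) => T x) Pi.topologicalSpace ⊓
    TopologicalSpace.induced (fun T (φ : StrongDual 𝕜 X) => adj T φ) Pi.topologicalSpace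

variable (𝕜 X) in
/-- The contractions on `X`, as a type of its own, carrying the strong-star topology only. -/
def Contraction : Type _ := {T : X →L[𝕜] X // ‖T‖ ≤ 1}

/-- The operator underlying a contraction. -/
def Contraction.toCLM (T : Contraction 𝕜 X) : X →L[𝕜] X := Subtype.val T

instance : TopologicalSpace (Contraction 𝕜 X) :=
  TopologicalSpace.induced Contraction.toCLM (sotStar 𝕜 X)

/-- `T` attains its norm: it has a norming vector. -/
def AttainsNorm (T : X →L[𝕜] X) : Prop :=
  ∃ z : X, z ≠ 0 ∧ ‖T z‖ = ‖T‖ * ‖z‖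

end

/-- A property is typical if the points satisfying it contain a dense `G_δ` set. -/
def IsTypical {M : Type*} [TopologicalSpace M] (p : M → Prop) : Prop :=
  ∃ G : Set M, IsGδ G ∧ Dense G ∧ ∀ T ∈ G, p T

end NormAttaining

/-!
If a contraction `T` preserves the norm of some `z ≠ 0`, then `adj T (J (T z))` and `J z` both norm `z`
and have the same norm, so smoothness makes them equal. Conversely `adj T (J (T z)) = J z` forces
`‖T z‖ = ‖z‖` (`IsDualityMapping.adj_apply_eq`, `IsDualityMapping.norm_le_norm_apply`). Thus
`‖T z‖ = ‖z‖`, which is not stable under weak limits of `z`, is traded for an equation that is closed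
jointly in `T` (strong-star topology) and `z` (weak topology on the unit ball). By reflexivity the
contractions that satisfy it for some `z` in a weakly compact subset of the ball form a closed set
(`isClosed_setOf_exists_adj_apply_eq`). Countably many weakly compact sets avoiding `0` cover the unit
sphere, because the dual is separable. So the contractions with `‖T z‖ < ‖z‖` for all `z ≠ 0` form a
`G_δ` set, which is dense because it contains every `T` with `‖T‖ < 1`.

On the other hand `‖T‖ = 1` is also a dense `G_δ` condition: the norm is lower semicontinuous, and if `P`
is a finite-rank `M`-like projection, then `P * T * P + (1 - P)` is a contraction of norm one, close to
`T` when `P` is close to the identity (`Contraction.dense_norm_eq_one`). The contractions form a Baire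
space (`Contraction.baireSpace`), so both conditions hold on a dense `G_δ` set, and there the norm is not
attained.
-/

namespace NormAttaining

section

variable {𝕜 X : Type*} [RCLike 𝕜] [NormedAddCommGroup X] [NormedSpace 𝕜 X]

/-! ### Norming functionals in a smooth space -/

/-- If `f` norms `z`, then `t ↦ ‖f‖ * ‖z + t • v‖ - Re (f (z + t • v))` has a minimum at `0`, so `f` is
the Gateaux differential of the norm at `z` up to the factor `‖f‖`. -/
lemma re_apply_eq_of_hasDerivAt_norm {f h : StrongDual 𝕜 X} {z v : X}
    (hf : f z = ((‖f‖ * ‖z‖ : ℝ) : 𝕜))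
    (hd : HasDerivAt (fun t : ℝ => ‖z + (t : 𝕜) • v‖) (RCLike.re (h v)) 0) :
    RCLike.re (f v) = ‖f‖ * RCLike.re (h v) := by
  have hlin : HasDerivAt (fun t : ℝ => RCLike.re (f z) + t * RCLike.re (f v))
      (RCLike.re (f v)) 0 := by
    simpa using ((hasDerivAt_id (0 : ℝ)).mul_const (RCLike.re (f v))).const_add (RCLike.re (f z))
  have hD := (hd.const_mul ‖f‖).sub hlin
  have hmin : IsLocalMin
      ((fun t : ℝ => ‖f‖ * ‖z + (t : 𝕜) • v‖) -
        fun t : ℝ => RCLike.re (f z) + t * RCLike.re (f v)) 0 := by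
    refine Filter.Eventually.of_forall fun t => ?_
    have h1 : RCLike.re (f (z + (t : 𝕜) • v)) ≤ ‖f‖ * ‖z + (t : 𝕜) • v‖ :=
      (RCLike.re_le_norm _).trans (f.le_opNorm _)
    rw [map_add, map_smul, smul_eq_mul, map_add, RCLike.re_ofReal_mul] at h1
    have h2 : RCLike.re (f z) = ‖f‖ * ‖z‖ := by rw [hf, RCLike.ofReal_re]
    simp only [Pi.sub_apply, RCLike.ofReal_zero, zero_smul, add_zero, zero_mul]
    linarith
  linarith [hmin.hasDerivAt_eq_zero hD]

lemma ext_re {f g : StrongDual 𝕜 X} (h : ∀ v, RCLike.re (f v) = RCLike.re (g v)) : f = g := by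
  ext v
  refine RCLike.ext (h v) ?_
  have := h ((RCLike.I : 𝕜) • v)
  simpa [RCLike.I_mul_re] using this

lemma IsSmooth.eq_of_norming (hs : IsSmooth 𝕜 X) {f g : StrongDual 𝕜 X} {z : X} (hz : z ≠ 0)
    (hfg : ‖f‖ = ‖g‖) (hf : f z = ((‖f‖ * ‖z‖ : ℝ) : 𝕜)) (hg : g z = ((‖g‖ * ‖z‖ : ℝ) : 𝕜)) :
    f = g := by
  obtain ⟨h, hh⟩ := hs z hz
  exact ext_re fun v => by
    rw [re_apply_eq_of_hasDerivAt_norm hf (hh v), re_apply_eq_of_hasDerivAt_norm hg (hh v), hfg]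

/-! ### Duality mappings and isometrically mapped vectors -/

lemma norm_adj_le {T : X →L[𝕜] X} (hT : ‖T‖ ≤ 1) (φ : StrongDual 𝕜 X) : ‖adj T φ‖ ≤ ‖φ‖ :=
  (φ.opNorm_comp_le T).trans (mul_le_of_le_one_right (norm_nonneg _) hT)

lemma norm_apply_le {T : X →L[𝕜] X} (hT : ‖T‖ ≤ 1) (x : X) : ‖T x‖ ≤ ‖x‖ := by
  simpa using T.le_of_opNorm_le hT x

/-- A contraction that preserves the norm of `z` satisfies an equation in `z` that, unlike
`‖T z‖ = ‖z‖`, survives weak limits of `z`. -/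
lemma IsDualityMapping.adj_apply_eq {J : X → StrongDual 𝕜 X} (hJ : IsDualityMapping J)
    (hs : IsSmooth 𝕜 X) {T : X →L[𝕜] X} (hT : ‖T‖ ≤ 1) {z : X} (hz : z ≠ 0) (h : ‖T z‖ = ‖z‖) :
    adj T (J (T z)) = J z := by
  obtain ⟨c, -, hc⟩ := hJ.norm_mono
  have hJn : ‖J (T z)‖ = ‖J z‖ := by rw [hc, hc, h]
  have hval : adj T (J (T z)) z = ((‖J z‖ * ‖z‖ : ℝ) : 𝕜) := by
    change J (T z) (T z) = _
    rw [hJ.pairing, hJn, h]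
  have hle : ‖adj T (J (T z))‖ ≤ ‖J z‖ := (norm_adj_le hT _).trans_eq hJn
  have hge : ‖J z‖ * ‖z‖ ≤ ‖adj T (J (T z))‖ * ‖z‖ := by
    have := (adj T (J (T z))).le_opNorm z
    rwa [hval, RCLike.norm_ofReal, abs_of_nonneg (by positivity)] at this
  have heq : ‖adj T (J (T z))‖ = ‖J z‖ :=
    le_antisymm hle (le_of_mul_le_mul_right hge (norm_pos_iff.2 hz))
  exact hs.eq_of_norming hz heq (by rw [hval, heq]) (hJ.pairing z)

lemma IsDualityMapping.norm_le_norm_apply {J : X → StrongDual 𝕜 X} (hJ : IsDualityMapping J)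
    {T : X →L[𝕜] X} (hT : ‖T‖ ≤ 1) {z : X} (hz : z ≠ 0) (h : adj T (J (T z)) = J z) :
    ‖z‖ ≤ ‖T z‖ := by
  obtain ⟨c, hc, hJc⟩ := hJ.norm_mono
  have hJn : ‖J (T z)‖ ≤ ‖J z‖ := by
    rw [hJc, hJc]
    exact hc (norm_nonneg _) (norm_nonneg _) (norm_apply_le hT z)
  have h1 : J (T z) (T z) = J z z := congrArg (fun f : StrongDual 𝕜 X => f z) h
  rw [hJ.pairing, hJ.pairing, RCLike.ofReal_inj] at h1
  have h2 : ‖J z‖ * ‖z‖ ≤ ‖J z‖ * ‖T z‖ := by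
    rw [← h1]
    gcongr
  exact le_of_mul_le_mul_left h2 (norm_pos_iff.2 (hJ.map_ne_zero z hz))

/-! ### The strong-star topology on contractions -/

/-- A contraction together with its adjoint, as a pair of functions. -/
def Contraction.toFunPair (T : Contraction 𝕜 X) :
    (X → X) × (StrongDual 𝕜 X → StrongDual 𝕜 X) :=
  (T.toCLM, adj T.toCLM)

lemma Contraction.norm_toCLM_le (T : Contraction 𝕜 X) : ‖T.toCLM‖ ≤ 1 := T.2

lemma Contraction.isInducing_toFunPair :
    IsInducing (Contraction.toFunPair : Contraction 𝕜 X → _) := by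
  constructor
  change TopologicalSpace.induced _ (_ ⊓ _) = TopologicalSpace.induced _ (_ ⊓ _)
  simp only [induced_inf, induced_compose]
  rfl

lemma Contraction.tendsto_iff {ι : Type*} {l : Filter ι} {u : ι → Contraction 𝕜 X}
    {T : Contraction 𝕜 X} :
    Tendsto u l (𝓝 T) ↔ (∀ x, Tendsto (fun i => (u i).toCLM x) l (𝓝 (T.toCLM x))) ∧
      ∀ φ, Tendsto (fun i => adj (u i).toCLM φ) l (𝓝 (adj T.toCLM φ)) := by
  rw [isInducing_toFunPair.tendsto_nhds_iff, nhds_prod_eq, tendsto_prod_iff', tendsto_pi_nhds,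
    tendsto_pi_nhds]
  rfl

lemma Contraction.continuous_apply (x : X) :
    Continuous fun T : Contraction 𝕜 X => T.toCLM x :=
  (_root_.continuous_apply x).comp (continuous_fst.comp isInducing_toFunPair.continuous)

lemma Contraction.continuous_adj (φ : StrongDual 𝕜 X) :
    Continuous fun T : Contraction 𝕜 X => adj T.toCLM φ :=
  (_root_.continuous_apply φ).comp (continuous_snd.comp isInducing_toFunPair.continuous)

/-- The uniformity of pointwise convergence on a family of `1`-Lipschitz maps is already induced by
the points of a dense sequence. -/
lemma isCountablyGenerated_comap_uniformity {ι Y Z : Type*} [PseudoMetricSpace Y]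
    [TopologicalSpace.SeparableSpace Y] [PseudoMetricSpace Z] (f : ι → Y → Z)
    (hf : ∀ i, LipschitzWith 1 (f i)) :
    (comap (fun p : ι × ι => (f p.1, f p.2)) (uniformity (Y → Z))).IsCountablyGenerated := by
  rcases isEmpty_or_nonempty Y with hY | hY
  · rw [Pi.uniformity, iInf_of_empty, comap_top]
    infer_instance
  have key : comap (fun p : ι × ι => (f p.1, f p.2)) (uniformity (Y → Z)) =
      ⨅ n : ℕ, comap (fun p : ι × ι => (f p.1 (TopologicalSpace.denseSeq Y n),
        f p.2 (TopologicalSpace.denseSeq Y n))) (uniformity Z) := by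
    rw [Pi.uniformity, comap_iInf]
    simp only [comap_comap]
    refine le_antisymm (le_iInf fun n => iInf_le _ _) (le_iInf fun y => ?_)
    refine tendsto_iff_comap.1 (Metric.uniformity_basis_dist.tendsto_right_iff.2 fun ε hε => ?_)
    obtain ⟨n, hn⟩ := (TopologicalSpace.denseRange_denseSeq Y).exists_dist_lt y
      (show 0 < ε / 3 by positivity)
    have hmem := mem_iInf_of_mem (f := fun n : ℕ => comap (fun p : ι × ι =>
      (f p.1 (TopologicalSpace.denseSeq Y n), f p.2 (TopologicalSpace.denseSeq Y n)))
      (uniformity Z)) n (preimage_mem_comap (Metric.dist_mem_uniformity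
        (show 0 < ε / 3 by positivity)))
    filter_upwards [hmem] with p hp
    have h1 := (hf p.1).dist_le_mul y (TopologicalSpace.denseSeq Y n)
    have h2 := (hf p.2).dist_le_mul (TopologicalSpace.denseSeq Y n) y
    rw [dist_comm (TopologicalSpace.denseSeq Y n) y] at h2
    simp only [NNReal.coe_one, one_mul] at h1 h2
    have h3 : dist (f p.1 (TopologicalSpace.denseSeq Y n))
      (f p.2 (TopologicalSpace.denseSeq Y n)) < ε / 3 := hp
    have h4 := dist_triangle4 (f p.1 y) (f p.1 (TopologicalSpace.denseSeq Y n))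
      (f p.2 (TopologicalSpace.denseSeq Y n)) (f p.2 y)
    change dist (f p.1 y) (f p.2 y) < ε
    linarith
  rw [key]
  infer_instance

/-- The pairs in the range are cut out by pointwise closed conditions. -/
lemma Contraction.isClosed_range_toFunPair :
    IsClosed (range (Contraction.toFunPair : Contraction 𝕜 X → _)) := by
  have hrange : range (Contraction.toFunPair : Contraction 𝕜 X → _) =
      {p | (∀ x y, p.1 (x + y) = p.1 x + p.1 y) ∧ (∀ (c : 𝕜) x, p.1 (c • x) = c • p.1 x) ∧
        (∀ x, ‖p.1 x‖ ≤ ‖x‖) ∧ ∀ (φ : StrongDual 𝕜 X) x, p.2 φ x = φ (p.1 x)} := by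
    ext ⟨f, g⟩
    constructor
    · rintro ⟨T, hT⟩
      rw [← hT]
      exact ⟨map_add T.toCLM, map_smul T.toCLM, norm_apply_le T.norm_toCLM_le, fun _ _ => rfl⟩
    · rintro ⟨h1, h2, h3, h4⟩
      let L : X →ₗ[𝕜] X := { toFun := f, map_add' := h1, map_smul' := h2 }
      refine ⟨⟨L.mkContinuous 1 fun x => (h3 x).trans_eq (one_mul _).symm,
        L.mkContinuous_norm_le zero_le_one _⟩, ?_⟩
      exact Prod.ext rfl (funext fun φ => ContinuousLinearMap.ext fun x => (h4 φ x).symm)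
  have hc (x : X) : Continuous
      fun p : (X → X) × (StrongDual 𝕜 X → StrongDual 𝕜 X) => p.1 x := by fun_prop
  rw [hrange]
  simp only [ofPred_and, ofPred_forall]
  refine IsClosed.inter (isClosed_iInter fun x => isClosed_iInter fun y =>
    isClosed_eq (hc _) ((hc _).add (hc _))) (IsClosed.inter (isClosed_iInter fun c =>
    isClosed_iInter fun x => isClosed_eq (hc _) ((hc _).const_smul c)) (IsClosed.inter
    (isClosed_iInter fun x => isClosed_le (hc _).norm continuous_const)
    (isClosed_iInter fun φ => isClosed_iInter fun x => isClosed_eq ?_ (φ.continuous.comp (hc x)))))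
  have : Continuous fun p : (X → X) × (StrongDual 𝕜 X → StrongDual 𝕜 X) => p.2 φ := by fun_prop
  exact (ContinuousLinearMap.apply 𝕜 𝕜 x).continuous.comp this

lemma Contraction.baireSpace [CompleteSpace X] [TopologicalSpace.SeparableSpace X]
    [TopologicalSpace.SeparableSpace (StrongDual 𝕜 X)] : BaireSpace (Contraction 𝕜 X) := by
  -- The pulled-back uniformity is complete because the range of `toFunPair` is closed; replacing its
  -- topology keeps the given one definitionally.
  let u : UniformSpace (Contraction 𝕜 X) :=
    (UniformSpace.comap Contraction.toFunPair inferInstance).replaceTopology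
      isInducing_toFunPair.eq_induced
  have hu : IsUniformInducing (Contraction.toFunPair : Contraction 𝕜 X → _) := ⟨rfl⟩
  have hcomplete : CompleteSpace (Contraction 𝕜 X) :=
    hu.completeSpace isClosed_range_toFunPair.isComplete
  have hX := isCountablyGenerated_comap_uniformity
    (fun (T : Contraction 𝕜 X) (x : X) => T.toCLM x)
    fun T => T.toCLM.lipschitz.weaken T.norm_toCLM_le
  have hX' := isCountablyGenerated_comap_uniformity
    (fun (T : Contraction 𝕜 X) (φ : StrongDual 𝕜 X) => adj T.toCLM φ)
    fun T => LipschitzWith.of_dist_le_mul fun φ ψ => by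
      rw [dist_eq_norm, dist_eq_norm, NNReal.coe_one, one_mul]
      exact norm_adj_le T.norm_toCLM_le (φ - ψ)
  have hgen : (uniformity (Contraction 𝕜 X)).IsCountablyGenerated := by
    rw [← hu.comap_uniformity, uniformity_prod, comap_inf, comap_comap, comap_comap]
    -- Separability of `X` and of its dual makes both factors countably generated.
    exact @Inf.isCountablyGenerated _ _ _ hX hX'
  infer_instance

/-! ### Closedness through weak compactness -/

lemma continuous_apply_of_norm_le {α E : Type*} [TopologicalSpace α] [NormedAddCommGroup E]
    [NormedSpace 𝕜 E] {f : α → StrongDual 𝕜 E} {C : ℝ} (hC : ∀ a, ‖f a‖ ≤ C)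
    (hf : ∀ x, Continuous fun a => f a x) {y : α → E} (hy : Continuous y) :
    Continuous fun a => f a (y a) := by
  refine continuous_iff_continuousAt.2 fun b => ?_
  have h0 : Tendsto (fun a => f a (y a - y b)) (𝓝 b) (𝓝 0) := by
    refine squeeze_zero_norm (fun a => (f a).le_of_opNorm_le (hC a) _) ?_
    have : Tendsto (fun a => C * ‖y a - y b‖) (𝓝 b) (𝓝 (C * ‖y b - y b‖)) :=
      (((hy.sub continuous_const).norm).const_mul C).tendsto b
    simpa using this
  have := h0.add ((hf (y b)).tendsto b)
  simpa [ContinuousAt] using this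

lemma IsReflexive.isCompact_closedBall (hr : IsReflexive 𝕜 X) :
    IsCompact (toWeakSpace 𝕜 X '' Metric.closedBall 0 1) := by
  have h := NormedSpace.isCompact_closure_of_isBounded 𝕜 X
    (toWeakSpace 𝕜 X '' Metric.closedBall 0 1)
    (by rw [preimage_image_eq _ (toWeakSpace 𝕜 X).injective]; exact Metric.isBounded_closedBall)
    (fun ξ _ => (hr ξ.toStrongDual).imp fun x hx => hx)
  refine h.of_isClosed_subset ?_ subset_closure
  have hball : toWeakSpace 𝕜 X '' Metric.closedBall 0 1 =
      {w : WeakSpace 𝕜 X | ∀ φ : StrongDual 𝕜 X, ‖φ ((toWeakSpace 𝕜 X).symm w)‖ ≤ ‖φ‖} := by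
    ext w
    obtain ⟨x, rfl⟩ := (toWeakSpace 𝕜 X).surjective w
    rw [(toWeakSpace 𝕜 X).injective.mem_set_image, mem_closedBall_zero_iff]
    simp only [mem_ofPred_eq, LinearEquiv.symm_apply_apply]
    refine ⟨fun hx φ => by simpa using φ.le_opNorm_of_le hx, fun hx => ?_⟩
    exact NormedSpace.norm_le_dual_bound 𝕜 x zero_le_one fun φ => by simpa using hx φ
  rw [hball]
  simp only [ofPred_forall]
  exact isClosed_iInter fun φ => isClosed_le
    (WeakBilin.eval_continuous (topDualPairing 𝕜 X).flip φ).norm continuous_const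

/-- The vectors of the unit ball on which `φ` is at least `1 / 2` in modulus. For `φ` in a dense subset
of the dual these weakly compact sets cover the unit sphere, and none contains `0`. -/
def ballSlice (φ : StrongDual 𝕜 X) : Set X := {z | ‖z‖ ≤ 1 ∧ 1 / 2 ≤ ‖φ z‖}

lemma IsReflexive.isCompact_ballSlice (hr : IsReflexive 𝕜 X) (φ : StrongDual 𝕜 X) :
    IsCompact (toWeakSpace 𝕜 X '' ballSlice φ) := by
  have : toWeakSpace 𝕜 X '' ballSlice φ = toWeakSpace 𝕜 X '' Metric.closedBall 0 1 ∩
      {w | 1 / 2 ≤ ‖φ ((toWeakSpace 𝕜 X).symm w)‖} := by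
    ext w
    obtain ⟨x, rfl⟩ := (toWeakSpace 𝕜 X).surjective w
    simp [(toWeakSpace 𝕜 X).injective.mem_set_image, ballSlice]
  rw [this]
  exact hr.isCompact_closedBall.inter_right (isClosed_le continuous_const
    (WeakBilin.eval_continuous (topDualPairing 𝕜 X).flip φ).norm)

lemma exists_mem_ballSlice {D : ℕ → StrongDual 𝕜 X} (hD : DenseRange D) {z : X} (hz : ‖z‖ = 1) :
    ∃ n, z ∈ ballSlice (D n) := by
  obtain ⟨f, -, hfz⟩ := exists_dual_vector 𝕜 z (hz.trans_ne one_ne_zero)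
  obtain ⟨n, hn⟩ := hD.exists_dist_lt f (show (0 : ℝ) < 1 / 2 by norm_num)
  refine ⟨n, hz.le, ?_⟩
  have h1 : ‖f z‖ = 1 := by rw [hfz, hz]; simp
  have h2 : ‖f z - D n z‖ ≤ 1 / 2 := by
    have := (f - D n).le_opNorm z
    rw [hz, mul_one, ← dist_eq_norm f] at this
    exact this.trans hn.le
  linarith [norm_sub_norm_le (f z) (D n z)]

/-- The pairs `(T, z)` with `adj T (J (T z)) = J z` form a closed set for the strong-star topology in
`T` and the weak topology in `z`; projecting along a weakly compact set of `z` keeps it closed. -/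
lemma isClosed_setOf_exists_adj_apply_eq {J : X → StrongDual 𝕜 X} (hJ : IsDualityMapping J)
    (hJc : IsWeakWeakStarContinuousOnBounded J) {K : Set X}
    (hK : IsCompact (toWeakSpace 𝕜 X '' K)) (hK1 : ∀ z ∈ K, ‖z‖ ≤ 1) :
    IsClosed {T : Contraction 𝕜 X | ∃ z ∈ K, adj T.toCLM (J (T.toCLM z)) = J z} := by
  obtain ⟨c, hc, hJn⟩ := hJ.norm_mono
  let W := toWeakSpace 𝕜 X '' K
  have : CompactSpace W := isCompact_iff_compactSpace.1 hK
  let v : W → X := fun w => (toWeakSpace 𝕜 X).symm w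
  have hvK (w : W) : v w ∈ K := by
    obtain ⟨_, x, hx, rfl⟩ := w
    simpa [v] using hx
  have hv (φ : StrongDual 𝕜 X) : Continuous fun w => φ (v w) :=
    (WeakBilin.eval_continuous (topDualPairing 𝕜 X).flip φ).comp continuous_subtype_val
  have hJball : ContinuousOn
      (fun x : WeakSpace 𝕜 X => StrongDual.toWeakDual (J ((toWeakSpace 𝕜 X).symm x)))
      (toWeakSpace 𝕜 X '' Metric.closedBall 0 1) := hJc _ Metric.isBounded_closedBall
  have hT1 (p : Contraction 𝕜 X × W) : ‖p.1.toCLM (v p.2)‖ ≤ 1 :=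
    (norm_apply_le p.1.norm_toCLM_le _).trans (hK1 _ (hvK _))
  -- `φ (T z) = (adj T φ) z`, where `adj T φ` varies norm-continuously and `z` stays bounded.
  have hTv : Continuous fun p : Contraction 𝕜 X × W =>
      toWeakSpace 𝕜 X (p.1.toCLM (v p.2)) := by
    refine WeakBilin.continuous_of_continuous_eval _ fun φ => ?_
    exact continuous_apply_of_norm_le (C := 1)
      (f := fun p : Contraction 𝕜 X × W => NormedSpace.inclusionInDoubleDual 𝕜 X (v p.2))
      (fun p => (NormedSpace.double_dual_bound 𝕜 X _).trans (hK1 _ (hvK _)))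
      (fun ψ => (hv ψ).comp continuous_snd) ((Contraction.continuous_adj φ).comp continuous_fst)
  have hJTv (x : X) : Continuous fun p : Contraction 𝕜 X × W => J (p.1.toCLM (v p.2)) x :=
    (WeakDual.eval_continuous x).comp (hJball.comp_continuous hTv fun p =>
      mem_image_of_mem _ (mem_closedBall_zero_iff.2 (hT1 p)))
  have hJv (x : X) : Continuous fun p : Contraction 𝕜 X × W => J (v p.2) x :=
    (WeakDual.eval_continuous x).comp (hJball.comp_continuous
      (continuous_subtype_val.comp continuous_snd) fun p => ⟨v p.2,
        mem_closedBall_zero_iff.2 (hK1 _ (hvK _)), (toWeakSpace 𝕜 X).apply_symm_apply _⟩)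
  have hclosed : IsClosed {p : Contraction 𝕜 X × W |
      ∀ x, J (p.1.toCLM (v p.2)) (p.1.toCLM x) = J (v p.2) x} := by
    rw [ofPred_forall]
    refine isClosed_iInter fun x => isClosed_eq (continuous_apply_of_norm_le (C := c 1)
      (fun p => ?_) hJTv ((Contraction.continuous_apply x).comp continuous_fst)) (hJv x)
    rw [hJn]
    exact hc (norm_nonneg _) (zero_le_one (α := ℝ)) (hT1 p)
  convert isClosedMap_fst_of_compactSpace _ hclosed using 1
  ext T
  constructor
  · rintro ⟨z, hz, h⟩
    refine ⟨(T, ⟨toWeakSpace 𝕜 X z, mem_image_of_mem _ hz⟩), fun x => ?_, rfl⟩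
    exact congrArg (fun f : StrongDual 𝕜 X => f x) h
  · rintro ⟨⟨T', w⟩, h, rfl⟩
    exact ⟨v w, hvK w, ContinuousLinearMap.ext h⟩

/-! ### Density of the strict contractions and of the operators of norm one -/

lemma Contraction.dense_norm_lt_one : Dense {T : Contraction 𝕜 X | ‖T.toCLM‖ < 1} := by
  intro T
  let r : ℕ → ℝ := fun k => 1 - 1 / ((k : ℝ) + 1)
  have hr0 (k : ℕ) : 0 ≤ r k := by
    have : 1 / ((k : ℝ) + 1) ≤ 1 := by
      rw [div_le_one (by positivity)]
      linarith [k.cast_nonneg (α := ℝ)]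
    exact sub_nonneg.2 this
  have hr1 (k : ℕ) : r k < 1 := sub_lt_self _ (by positivity)
  have hr : Tendsto (fun k => (r k : 𝕜)) atTop (𝓝 1) := by
    have h : Tendsto r atTop (𝓝 1) := by
      simpa [r] using (tendsto_one_div_add_atTop_nhds_zero_nat (𝕜 := ℝ)).const_sub 1
    simpa [Function.comp_def] using ((RCLike.continuous_ofReal (K := 𝕜)).tendsto 1).comp h
  have hnorm (k : ℕ) : ‖(r k : 𝕜) • T.toCLM‖ < 1 := by
    rw [norm_smul, RCLike.norm_ofReal, abs_of_nonneg (hr0 k)]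
    exact (mul_le_of_le_one_right (hr0 k) T.norm_toCLM_le).trans_lt (hr1 k)
  let u : ℕ → Contraction 𝕜 X := fun k => ⟨(r k : 𝕜) • T.toCLM, (hnorm k).le⟩
  have hu : Tendsto u atTop (𝓝 T) := by
    refine Contraction.tendsto_iff.2 ⟨fun x => ?_, fun φ => ?_⟩
    · have h := hr.smul_const (T.toCLM x)
      rw [one_smul] at h
      exact h
    · have h := hr.smul_const (adj T.toCLM φ)
      rw [one_smul] at h
      refine h.congr fun k => ?_
      ext x
      exact (map_smul φ (r k : 𝕜) (T.toCLM x)).symm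
  exact mem_closure_of_tendsto hu (Eventually.of_forall hnorm)

lemma IsMLikeProjection.norm_le_one {P : X →L[𝕜] X} (hP : IsMLikeProjection P) :
    ‖P‖ ≤ 1 ∧ ‖1 - P‖ ≤ 1 := by
  have h := hP.norm_eq 1
  have hQ : (1 - P) * (1 - P) = 1 - P := by
    rw [mul_sub, sub_mul, sub_mul, hP.idem]; simp
  rw [mul_one, mul_one, hP.idem, hQ, add_sub_cancel] at h
  have h1 : ‖(1 : X →L[𝕜] X)‖ ≤ 1 := ContinuousLinearMap.norm_id_le
  exact ⟨(le_max_left _ _).trans (h.symm.le.trans h1),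
    (le_max_right _ _).trans (h.symm.le.trans h1)⟩

/-- `P * T * P + (1 - P)` is block diagonal for `P`, and its block `1 - P` alone has norm one. -/
lemma IsMLikeProjection.norm_compression_add {P : X →L[𝕜] X} (hP : IsMLikeProjection P)
    (hP1 : P ≠ 1) {T : X →L[𝕜] X} (hT : ‖T‖ ≤ 1) : ‖P * T * P + (1 - P)‖ = 1 := by
  have hQ : (1 - P) * (1 - P) = 1 - P := by
    rw [mul_sub, sub_mul, sub_mul, hP.idem]; simp
  have hPQ : P * (1 - P) = 0 := by rw [mul_sub, hP.idem, mul_one, sub_self]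
  have hQP : (1 - P) * P = 0 := by rw [sub_mul, hP.idem, one_mul, sub_self]
  have e1 : P * (P * T * P + (1 - P)) * P = P * T * P := by
    rw [mul_add, hPQ, add_zero, ← mul_assoc, ← mul_assoc, hP.idem, mul_assoc, hP.idem]
  have e2 : (1 - P) * (P * T * P + (1 - P)) * (1 - P) = 1 - P := by
    rw [mul_add, ← mul_assoc, ← mul_assoc, hQP, zero_mul, zero_mul, zero_add, hQ, hQ]
  have h := hP.norm_eq (P * T * P + (1 - P))
  rw [e1, e2] at h
  obtain ⟨hn, hnQ⟩ := hP.norm_le_one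
  have hQ1 : 1 ≤ ‖1 - P‖ := by
    have hpos : 0 < ‖1 - P‖ := norm_pos_iff.2 (sub_ne_zero.2 hP1.symm)
    have := norm_mul_le (1 - P) (1 - P)
    rw [hQ] at this
    exact le_of_mul_le_mul_right (by simpa using this) hpos
  have hPTP : ‖P * T * P‖ ≤ 1 :=
    (norm_mul_le _ _).trans (mul_le_one₀ ((norm_mul_le _ _).trans
      (mul_le_one₀ hn (norm_nonneg _) hT)) (norm_nonneg _) hn)
  rw [h, le_antisymm hnQ hQ1]
  exact max_eq_right hPTP

lemma tendsto_compression_apply {E : Type*} [NormedAddCommGroup E] {A : ℕ → E → E} {S : E → E}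
    (hS : Continuous S) (hA : ∀ N x y, ‖A N x - A N y‖ ≤ ‖x - y‖)
    (hlim : ∀ x, Tendsto (fun N => A N x) atTop (𝓝 x)) (x : E) :
    Tendsto (fun N => A N (S (A N x))) atTop (𝓝 (S x)) := by
  have h1 : Tendsto (fun N => S (A N x) - S x) atTop (𝓝 0) := by
    simpa using ((hS.tendsto x).comp (hlim x)).sub_const (S x)
  have h2 : Tendsto (fun N => A N (S (A N x)) - A N (S x)) atTop (𝓝 0) :=
    squeeze_zero_norm (fun N => hA N _ _) (by simpa using h1.norm)
  simpa using h2.add (hlim (S x))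

lemma tendsto_sotStar_one {P : ℕ → X →L[𝕜] X}
    (h : Tendsto P atTop (@nhds (X →L[𝕜] X) (sotStar 𝕜 X) 1)) :
    (∀ x, Tendsto (fun N => P N x) atTop (𝓝 x)) ∧
      ∀ φ, Tendsto (fun N => adj (P N) φ) atTop (𝓝 φ) := by
  have h1 := h.mono_right (nhds_mono (inf_le_left : sotStar 𝕜 X ≤ _))
  have h2 := h.mono_right (nhds_mono (inf_le_right : sotStar 𝕜 X ≤ _))
  rw [nhds_induced, tendsto_comap_iff, tendsto_pi_nhds] at h1 h2
  exact ⟨h1, h2⟩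

lemma Contraction.dense_norm_eq_one (hdim : ¬ FiniteDimensional 𝕜 X) {P : ℕ → X →L[𝕜] X}
    (hP : ∀ N, IsMLikeProjection (P N))
    (hfin : ∀ N, FiniteDimensional 𝕜 (LinearMap.range (P N).toLinearMap))
    (hlim : Tendsto P atTop (@nhds (X →L[𝕜] X) (sotStar 𝕜 X) 1)) :
    Dense {T : Contraction 𝕜 X | ‖T.toCLM‖ = 1} := by
  obtain ⟨hx, hφ⟩ := tendsto_sotStar_one hlim
  have hne (N : ℕ) : P N ≠ 1 := by
    intro h
    refine hdim ?_
    have hf := hfin N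
    have htop : LinearMap.range (P N).toLinearMap = ⊤ := by
      rw [h]
      exact LinearMap.range_id
    rw [htop] at hf
    exact Module.Finite.equiv (Submodule.topEquiv (R := 𝕜) (M := X))
  intro T
  have hnorm (N : ℕ) := (hP N).norm_compression_add (hne N) T.norm_toCLM_le
  let u : ℕ → Contraction 𝕜 X := fun N => ⟨P N * T.toCLM * P N + (1 - P N), (hnorm N).le⟩
  have hu : Tendsto u atTop (𝓝 T) := by
    refine Contraction.tendsto_iff.2 ⟨fun x => ?_, fun φ => ?_⟩
    · have h1 := tendsto_compression_apply (A := fun N x => P N x) T.toCLM.continuous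
        (fun N x y => by
          rw [← map_sub]
          exact norm_apply_le (hP N).norm_le_one.1 _) hx x
      have h2 := h1.add ((hx x).const_sub x)
      rw [sub_self, add_zero] at h2
      exact h2
    · have h1 := tendsto_compression_apply (A := fun N ψ => adj (P N) ψ) (S := adj T.toCLM)
        (LipschitzWith.of_dist_le_mul (K := 1) fun ψ₁ ψ₂ => by
          rw [dist_eq_norm, dist_eq_norm, NNReal.coe_one, one_mul]
          exact norm_adj_le T.norm_toCLM_le (ψ₁ - ψ₂)).continuous
        (fun N ψ₁ ψ₂ => norm_adj_le (hP N).norm_le_one.1 (ψ₁ - ψ₂)) hφ φ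
      have h2 := h1.add ((hφ φ).const_sub φ)
      rw [sub_self, add_zero] at h2
      refine h2.congr fun N => ?_
      ext x
      change φ (P N (T.toCLM (P N x))) + (φ x - φ (P N x)) =
        φ (P N (T.toCLM (P N x)) + (x - P N x))
      rw [map_add, map_sub]
  exact mem_closure_of_tendsto hu (Eventually.of_forall hnorm)

lemma Contraction.isOpen_lt_norm {a : ℝ} (ha : 0 ≤ a) :
    IsOpen {T : Contraction 𝕜 X | a < ‖T.toCLM‖} := by
  have : {T : Contraction 𝕜 X | a < ‖T.toCLM‖} = ⋃ x : X, {T | a * ‖x‖ < ‖T.toCLM x‖} := by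
    ext T
    simp only [mem_ofPred_eq, mem_iUnion]
    constructor
    · intro h
      by_contra! hcon
      exact h.not_ge (T.toCLM.opNorm_le_bound ha hcon)
    · rintro ⟨x, hx⟩
      exact lt_of_mul_lt_mul_right (hx.trans_le (T.toCLM.le_opNorm x)) (norm_nonneg x)
  rw [this]
  exact isOpen_iUnion fun x => isOpen_lt continuous_const (continuous_apply x).norm

/-- The functionals `φ ∘ P N` lie in a finite-dimensional space for each `N`, and approximate `φ`. -/
lemma separableSpace_dual_of_tendsto {P : ℕ → X →L[𝕜] X}
    (hfin : ∀ N, FiniteDimensional 𝕜 (LinearMap.range (P N).toLinearMap))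
    (hlim : ∀ φ, Tendsto (fun N => adj (P N) φ) atTop (𝓝 φ)) :
    TopologicalSpace.SeparableSpace (StrongDual 𝕜 X) := by
  have hsep (N : ℕ) : TopologicalSpace.IsSeparable (range (adj (P N))) := by
    have := hfin N
    have : ProperSpace (StrongDual 𝕜 (LinearMap.range (P N).toLinearMap)) :=
      FiniteDimensional.proper 𝕜 _
    let R : X →L[𝕜] LinearMap.range (P N).toLinearMap :=
      (P N).codRestrict _ fun x => LinearMap.mem_range_self _ x
    have hc : Continuous
        fun ψ : StrongDual 𝕜 (LinearMap.range (P N).toLinearMap) => ψ.comp R := by fun_prop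
    refine (TopologicalSpace.isSeparable_range hc).mono ?_
    rintro _ ⟨φ, rfl⟩
    exact ⟨φ.comp (Submodule.subtypeL _), rfl⟩
  rw [← TopologicalSpace.isSeparable_univ_iff]
  refine (TopologicalSpace.IsSeparable.iUnion hsep).closure.mono fun φ _ => ?_
  exact mem_closure_of_tendsto (hlim φ)
    (Eventually.of_forall fun N => mem_iUnion.2 ⟨N, mem_range_self φ⟩)

end

end NormAttaining

theorem mainTheorem6 {𝕜 X : Type*} [RCLike 𝕜] [NormedAddCommGroup X] [NormedSpace 𝕜 X]
    [CompleteSpace X] [TopologicalSpace.SeparableSpace X]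
    (hdim : ¬ FiniteDimensional 𝕜 X)
    (hrefl : NormAttaining.IsReflexive 𝕜 X)
    (hsmooth : NormAttaining.IsSmooth 𝕜 X)
    (hJ : ∃ J : X → StrongDual 𝕜 X, NormAttaining.IsDualityMapping J ∧
      NormAttaining.IsWeakWeakStarContinuousOnBounded J)
    (hP : ∃ P : ℕ → X →L[𝕜] X,
      (∀ N, NormAttaining.IsMLikeProjection (P N) ∧
        FiniteDimensional 𝕜 (LinearMap.range (P N).toLinearMap)) ∧
      Tendsto P atTop (@nhds (X →L[𝕜] X) (NormAttaining.sotStar 𝕜 X) 1)) :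
    NormAttaining.IsTypical
      (fun T : NormAttaining.Contraction 𝕜 X => ¬ NormAttaining.AttainsNorm T.toCLM) := by
  open NormAttaining in
  obtain ⟨J, hJ, hJc⟩ := hJ
  obtain ⟨P, hP, hlim⟩ := hP
  have := separableSpace_dual_of_tendsto (fun N => (hP N).2) (tendsto_sotStar_one hlim).2
  have : BaireSpace (Contraction 𝕜 X) := Contraction.baireSpace
  let D := TopologicalSpace.denseSeq (StrongDual 𝕜 X)
  let A : ℕ → Set (Contraction 𝕜 X) := fun n =>
    {T | ∃ z ∈ ballSlice (D n), adj T.toCLM (J (T.toCLM z)) = J z}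
  let a : ℕ → ℝ := fun n => 1 - 1 / ((n : ℝ) + 1)
  let B : ℕ → Set (Contraction 𝕜 X) := fun n => {T | a n < ‖T.toCLM‖}
  have ha0 (n : ℕ) : 0 ≤ a n := by
    have : 1 / ((n : ℝ) + 1) ≤ 1 := by
      rw [div_le_one (by positivity)]
      linarith [n.cast_nonneg (α := ℝ)]
    exact sub_nonneg.2 this
  have hAo (n : ℕ) : IsOpen (A n)ᶜ := (isClosed_setOf_exists_adj_apply_eq hJ hJc
    (hrefl.isCompact_ballSlice (D n)) fun z hz => hz.1).isOpen_compl
  have hBo (n : ℕ) : IsOpen (B n) := Contraction.isOpen_lt_norm (ha0 n)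
  have hAd (n : ℕ) : Dense (A n)ᶜ := by
    refine Contraction.dense_norm_lt_one.mono ?_
    rintro T hT ⟨z, hz, hzJ⟩
    have hz0 : z ≠ 0 := by
      rintro rfl
      have := hz.2
      norm_num at this
    have h1 := hJ.norm_le_norm_apply T.norm_toCLM_le hz0 hzJ
    have h2 : ‖T.toCLM‖ * ‖z‖ < 1 * ‖z‖ := mul_lt_mul_of_pos_right hT (norm_pos_iff.2 hz0)
    linarith [T.toCLM.le_opNorm z]
  have hBd (n : ℕ) : Dense (B n) := by
    refine (Contraction.dense_norm_eq_one hdim (fun N => (hP N).1) (fun N => (hP N).2) hlim).mono ?_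
    intro T hT
    change a n < ‖T.toCLM‖
    rw [show ‖T.toCLM‖ = 1 from hT]
    exact sub_lt_self _ (by positivity)
  have hGo (n : ℕ) : IsOpen ((A n)ᶜ ∩ B n) := (hAo n).inter (hBo n)
  refine ⟨⋂ n, (A n)ᶜ ∩ B n, IsGδ.iInter_of_isOpen hGo, dense_iInter_of_isOpen_nat hGo
    fun n => (hAd n).inter_of_isOpen_left (hBd n) (hAo n), fun T hT => ?_⟩
  rw [mem_iInter] at hT
  have hnorm : ‖T.toCLM‖ = 1 := by
    refine le_antisymm T.norm_toCLM_le (le_of_tendsto' (f := a) (x := atTop) ?_ fun n => (hT n).2.le)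
    simpa [a] using (tendsto_one_div_add_atTop_nhds_zero_nat (𝕜 := ℝ)).const_sub 1
  rintro ⟨z, hz, hTz⟩
  rw [hnorm, one_mul] at hTz
  let w : X := ((‖z‖⁻¹ : ℝ) : 𝕜) • z
  have hw : ‖w‖ = 1 := by
    rw [norm_smul, RCLike.norm_ofReal, abs_of_nonneg (by positivity),
      inv_mul_cancel₀ (norm_ne_zero_iff.2 hz)]
  have hTw : ‖T.toCLM w‖ = ‖w‖ := by
    rw [map_smul, norm_smul, norm_smul, hTz]
  have hw0 : w ≠ 0 := norm_ne_zero_iff.1 (by rw [hw]; exact one_ne_zero)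
  obtain ⟨n, hn⟩ := exists_mem_ballSlice
    (TopologicalSpace.denseRange_denseSeq (StrongDual 𝕜 X)) hw
  exact (hT n).1 ⟨w, hn, hJ.adj_apply_eq hsmooth T.norm_toCLM_le hw0 hTw⟩
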